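/- **Setting.** A vector lattice is a lattice-ordered real vector space; it is Archimedean if $0\le f$ and $nf\le g$ for all $n\in\mathbb N$ imply $f=0$. A vector lattice homomorphism is a linear map $T$ with $T|f|=|Tf|$; a vector lattice bimorphism is a bilinear map that is a vector lattice homomorphism in each variable whenever the other variable is a fixed positive element. The (Fremlin) tensor product $E\bar\otimes F$ of Archimedean vector lattices $E,F$ is the essentially unique Archimedean vector lattice with a vector lattice bimorphism $\bar\otimes:E\times F\to E\bar\otimes F$ such that every vector lattice bimorphism $\varphi:E\times F\to G$ into an Archimedean vector lattice $G$ is $h\circ\bar\otimes$ for exactly one vector lattice homomorphism $h:E\bar\otimes F\to G$. A vector lattice $E$ is square mean complete if $\sup\{f\cos\theta+g\sin\theta:\theta\in[0,2\pi]\}$ exists in $E$ for all $f,g\in E$. An Archimedean modulus on a complex vector space $V$ is an idempotent map $m:V\to V$ such that, for all $f,g\in V$ and $\alpha\in\mathbb C$: $m(\alpha f)=|\alpha|m(f)$; $m\bigl(m(m(f)+m(g))-m(f+g)\bigr)=m(f)+m(g)-m(f+g)$; $V$ is the complex linear span of $m(V)$; and if $m(m(g)-nm(f))=m(g)-nm(f)$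 for all $n\ge1$, then $f=0$. The complexification $E_{\mathbb C}=E+iE$ of a vector lattice $E$ is an Archimedean vector lattice over $\mathbb C$ if it carries an Archimedean modulus that extends the absolute value of $E$. For topological spaces $A,B$, $C(A)$ is the vector lattice of continuous real functions on $A$, and $C(A)\otimes C(B)$ is the linear span in $C(A\times B)$ of the functions $(a,b)\mapsto f(a)g(b)$ with $f\in C(A)$, $g\in C(B)$. **Theorem 4.10.** Let $X$ and $Y$ be nonempty subsets of $\mathbb R$ without isolated points. Then $C(X)\bar\otimes C(Y)$ is not square mean complete, and its vector space complexification $(C(X)\bar\otimes C(Y))_{\mathbb C}$ is not an Archimedean vector lattice over $\mathbb C$. More precisely, let $\Phi:C(X)\bar\otimes C(Y)\to C(X\times Y)$ be the vector lattice homomorphism with $\Phi(f\bar\otimes g)(x,y)=f(x)g(y)$, let $S(x,y)=\sqrt{x^2+y^2}$, and let $x\in C(X)$ and $y\in C(Y)$ also denote the coordinate functions. Then: 1. $\{\cos\theta\,(x\bar\otimes1)+\sin\theta\,(1\bar\otimes y):\theta\in[0,2\pi]\}$ has no supremum in $C(X)\bar\otimes C(Y)$, and $S$ is not in the range of $\Phi$.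 2. For all nonempty open sets $U\subseteq X$ and $W\subseteq Y$, $S|_{U\times W}\notin C(U)\otimes C(W)$. 3. For every $t\in C(X)\bar\otimes C(Y)$, every nonempty open subset of $X\times Y$ contains a nonempty open set $V$ on which $\Phi(t)$ agrees with an element of $C(X)\otimes C(Y)$. -/

import Mathlib

open scoped TensorProduct

universe u

namespace VecLat

/-- An Archimedean vector lattice over `ℝ`: a lattice-ordered real vector space such that
`n • f ≤ g` for all `n` and `0 ≤ f` force `f = 0`. -/
class ArchVectorLattice (E : Type*) [AddCommGroup E] [Lattice E] [Module ℝ E] : Prop extends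
    IsOrderedAddMonoid E, PosSMulMono ℝ E where
  arch : ∀ f g : E, 0 ≤ f → (∀ n : ℕ, n • f ≤ g) → f = 0

/-- A vector lattice homomorphism: a linear map that preserves the absolute value. -/
def IsLatticeHom {E F : Type*} [AddCommGroup E] [Lattice E] [Module ℝ E]
    [AddCommGroup F] [Lattice F] [Module ℝ F] (T : E →ₗ[ℝ] F) : Prop :=
  ∀ f : E, T |f| = |T f|

/-- A vector lattice bimorphism: a bilinear map which is a vector lattice homomorphism in each
variable whenever the other variable is a fixed positive element. -/
def IsBimorphism {E F G : Type*} [AddCommGroup E] [Lattice E] [Module ℝ E]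
    [AddCommGroup F] [Lattice F] [Module ℝ F] [AddCommGroup G] [Lattice G] [Module ℝ G]
    (T : E →ₗ[ℝ] F →ₗ[ℝ] G) : Prop :=
  (∀ e : E, 0 ≤ e → IsLatticeHom (T e)) ∧ (∀ f : F, 0 ≤ f → IsLatticeHom (T.flip f))

/-- `(T, τ)` is an Archimedean vector lattice tensor product of `E` and `F`. -/
structure IsTensorProduct {E F T : Type u} [AddCommGroup E] [Lattice E] [Module ℝ E]
    [AddCommGroup F] [Lattice F] [Module ℝ F] [AddCommGroup T] [Lattice T] [Module ℝ T]
    (τ : E →ₗ[ℝ] F →ₗ[ℝ] T) : Prop where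
  arch : ArchVectorLattice T
  bimorphism : IsBimorphism τ
  universal : ∀ (G : Type u) [AddCommGroup G] [Lattice G] [Module ℝ G] [ArchVectorLattice G]
    (φ : E →ₗ[ℝ] F →ₗ[ℝ] G), IsBimorphism φ →
      ∃! h : T →ₗ[ℝ] G, IsLatticeHom h ∧ ∀ e f, h (τ e f) = φ e f

/-! ### Construction of the Fremlin tensor product

Formal vector lattice expressions in the symbols `e ⊗ f`, two of them being identified if they
have the same value under every vector lattice bimorphism into an Archimedean vector lattice. -/

/-- Formal vector lattice expressions in the symbols `pure e f`. -/
inductive Expr (E F : Type u) : Type u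
  | pure : E → F → Expr E F
  | zero : Expr E F
  | add : Expr E F → Expr E F → Expr E F
  | smul : ℝ → Expr E F → Expr E F
  | sup : Expr E F → Expr E F → Expr E F

section Construction

variable (E F : Type u) [AddCommGroup E] [Lattice E] [Module ℝ E]
  [AddCommGroup F] [Lattice F] [Module ℝ F]

variable {E F} in
/-- The value of a formal expression under a bilinear map. -/
def Expr.eval {G : Type u} [AddCommGroup G] [Lattice G] [Module ℝ G]
    (φ : E →ₗ[ℝ] F →ₗ[ℝ] G) : Expr E F → G
  | .pure e f => φ e f
  | .zero => 0
  | .add a b => a.eval φ + b.eval φ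
  | .smul r a => r • a.eval φ
  | .sup a b => a.eval φ ⊔ b.eval φ

/-- Equality under every bimorphism into an Archimedean vector lattice. -/
def exprSetoid : Setoid (Expr E F) where
  r a b := ∀ (G : Type u) [AddCommGroup G] [Lattice G] [Module ℝ G] [ArchVectorLattice G]
    (φ : E →ₗ[ℝ] F →ₗ[ℝ] G), IsBimorphism φ → a.eval φ = b.eval φ
  iseqv :=
    { refl := fun _ _ _ _ _ _ _ _ => rfl
      symm := fun h G _ _ _ _ φ hφ => (h G φ hφ).symm
      trans := fun h k G _ _ _ _ φ hφ => (h G φ hφ).trans (k G φ hφ) }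

/-- The Fremlin tensor product of two Archimedean vector lattices. -/
def FremlinTensor : Type u := Quotient (exprSetoid E F)

namespace FremlinTensor

variable {E F}

/-- The value of an element of the tensor product under a bimorphism. -/
def eval {G : Type u} [AddCommGroup G] [Lattice G] [Module ℝ G] [ArchVectorLattice G]
    (φ : E →ₗ[ℝ] F →ₗ[ℝ] G) (hφ : IsBimorphism φ) : FremlinTensor E F → G :=
  Quotient.lift (fun a => a.eval φ) (fun _ _ h => h G φ hφ)

theorem ext {x y : FremlinTensor E F}
    (h : ∀ (G : Type u) [AddCommGroup G] [Lattice G] [Module ℝ G] [ArchVectorLattice G]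
      (φ : E →ₗ[ℝ] F →ₗ[ℝ] G) (hφ : IsBimorphism φ), eval φ hφ x = eval φ hφ y) : x = y := by
  induction x using Quotient.inductionOn
  induction y using Quotient.inductionOn
  exact Quotient.sound fun G _ _ _ _ φ hφ => h G φ hφ

instance : Zero (FremlinTensor E F) := ⟨Quotient.mk _ .zero⟩

instance : Add (FremlinTensor E F) :=
  ⟨Quotient.map₂ .add fun _ _ h _ _ k G _ _ _ _ φ hφ =>
    congrArg₂ (· + ·) (h G φ hφ) (k G φ hφ)⟩

instance : SMul ℝ (FremlinTensor E F) :=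
  ⟨fun r => Quotient.map (.smul r) fun _ _ h G _ _ _ _ φ hφ => congrArg (r • ·) (h G φ hφ)⟩

/-- The supremum of two elements. -/
def sup : FremlinTensor E F → FremlinTensor E F → FremlinTensor E F :=
  Quotient.map₂ .sup fun _ _ h _ _ k G _ _ _ _ φ hφ =>
    congrArg₂ (· ⊔ ·) (h G φ hφ) (k G φ hφ)

instance : Neg (FremlinTensor E F) := ⟨fun x => (-1 : ℝ) • x⟩

/-- `x ≤ y` if `φ x ≤ φ y` for every bimorphism `φ`; equivalently `x ⊔ y = y`. -/
instance : LE (FremlinTensor E F) :=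
  ⟨fun x y => ∀ (G : Type u) [AddCommGroup G] [Lattice G] [Module ℝ G] [ArchVectorLattice G]
    (φ : E →ₗ[ℝ] F →ₗ[ℝ] G) (hφ : IsBimorphism φ), eval φ hφ x ≤ eval φ hφ y⟩

section

variable {G : Type u} [AddCommGroup G] [Lattice G] [Module ℝ G] [ArchVectorLattice G]
  (φ : E →ₗ[ℝ] F →ₗ[ℝ] G) (hφ : IsBimorphism φ)

theorem eval_mono {x y : FremlinTensor E F} (h : x ≤ y) : eval φ hφ x ≤ eval φ hφ y :=
  h G φ hφ

@[simp] theorem eval_zero : eval φ hφ (0 : FremlinTensor E F) = 0 := rfl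

@[simp] theorem eval_add (x y : FremlinTensor E F) :
    eval φ hφ (x + y) = eval φ hφ x + eval φ hφ y := by
  induction x using Quotient.inductionOn
  induction y using Quotient.inductionOn
  rfl

@[simp] theorem eval_smul (r : ℝ) (x : FremlinTensor E F) :
    eval φ hφ (r • x) = r • eval φ hφ x := by
  induction x using Quotient.inductionOn
  rfl

theorem eval_sup_aux (x y : FremlinTensor E F) :
    eval φ hφ (sup x y) = eval φ hφ x ⊔ eval φ hφ y := by
  induction x using Quotient.inductionOn
  induction y using Quotient.inductionOn
  rfl

@[simp] theorem eval_neg (x : FremlinTensor E F) : eval φ hφ (-x) = -eval φ hφ x := by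
  change eval φ hφ ((-1 : ℝ) • x) = _
  simp

end

instance : AddCommGroup (FremlinTensor E F) where
  add_assoc x y z := ext fun _ _ _ _ _ φ hφ => by simp [add_assoc]
  zero_add x := ext fun _ _ _ _ _ φ hφ => by simp
  add_zero x := ext fun _ _ _ _ _ φ hφ => by simp
  add_comm x y := ext fun _ _ _ _ _ φ hφ => by simp [add_comm]
  neg_add_cancel x := ext fun _ _ _ _ _ φ hφ => by simp
  nsmul := nsmulRec
  zsmul := zsmulRec

instance : Module ℝ (FremlinTensor E F) where
  one_smul x := ext fun _ _ _ _ _ φ hφ => by simp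
  mul_smul r s x := ext fun _ _ _ _ _ φ hφ => by simp [mul_smul]
  smul_zero r := ext fun _ _ _ _ _ φ hφ => by simp
  smul_add r x y := ext fun _ _ _ _ _ φ hφ => by simp
  add_smul r s x := ext fun _ _ _ _ _ φ hφ => by simp [add_smul]
  zero_smul x := ext fun _ _ _ _ _ φ hφ => by simp

instance : Lattice (FremlinTensor E F) where
  le_refl x _ _ _ _ _ φ hφ := le_rfl
  le_trans x y z h k G _ _ _ _ φ hφ := (h G φ hφ).trans (k G φ hφ)
  le_antisymm x y h k := ext fun G _ _ _ _ φ hφ => (h G φ hφ).antisymm (k G φ hφ)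
  sup := sup
  inf x y := -sup (-x) (-y)
  le_sup_left x y _ _ _ _ _ φ hφ := by simp [eval_sup_aux]
  le_sup_right x y _ _ _ _ _ φ hφ := by simp [eval_sup_aux]
  sup_le x y z h k _ _ _ _ _ φ hφ := by
    simpa [eval_sup_aux] using ⟨eval_mono φ hφ h, eval_mono φ hφ k⟩
  inf_le_left x y _ _ _ _ _ φ hφ := by simp [eval_sup_aux, neg_sup]
  inf_le_right x y _ _ _ _ _ φ hφ := by simp [eval_sup_aux, neg_sup]
  le_inf x y z h k _ _ _ _ _ φ hφ := by
    simpa [eval_sup_aux, neg_sup] using ⟨eval_mono φ hφ h, eval_mono φ hφ k⟩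

@[simp] theorem eval_sup {G : Type u} [AddCommGroup G] [Lattice G] [Module ℝ G]
    [ArchVectorLattice G] (φ : E →ₗ[ℝ] F →ₗ[ℝ] G) (hφ : IsBimorphism φ)
    (x y : FremlinTensor E F) : eval φ hφ (x ⊔ y) = eval φ hφ x ⊔ eval φ hφ y :=
  eval_sup_aux φ hφ x y

/-- The linear map induced by a bimorphism. -/
def lift {G : Type u} [AddCommGroup G] [Lattice G] [Module ℝ G] [ArchVectorLattice G]
    (φ : E →ₗ[ℝ] F →ₗ[ℝ] G) (hφ : IsBimorphism φ) : FremlinTensor E F →ₗ[ℝ] G where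
  toFun := eval φ hφ
  map_add' := eval_add φ hφ
  map_smul' := eval_smul φ hφ

variable (E F) in
/-- The canonical bilinear map `(e, f) ↦ e ⊗ f` into the Fremlin tensor product. -/
def tmul : E →ₗ[ℝ] F →ₗ[ℝ] FremlinTensor E F :=
  LinearMap.mk₂ ℝ (fun e f => Quotient.mk _ (.pure e f))
    (fun e e' f => Quotient.sound fun _ _ _ _ _ φ _ => φ.map_add₂ e e' f)
    (fun r e f => Quotient.sound fun _ _ _ _ _ φ _ => φ.map_smul₂ r e f)
    (fun e f f' => Quotient.sound fun _ _ _ _ _ φ _ => (φ e).map_add f f')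
    (fun r e f => Quotient.sound fun _ _ _ _ _ φ _ => (φ e).map_smul r f)

@[simp] theorem eval_tmul {G : Type u} [AddCommGroup G] [Lattice G] [Module ℝ G]
    [ArchVectorLattice G] (φ : E →ₗ[ℝ] F →ₗ[ℝ] G) (hφ : IsBimorphism φ) (e : E) (f : F) :
    eval φ hφ (tmul E F e f) = φ e f := rfl

instance : ArchVectorLattice (FremlinTensor E F) where
  add_le_add_left x y h z G _ _ _ _ φ hφ := by
    simpa using eval_mono φ hφ h
  smul_le_smul_of_nonneg_left r hr x y h G _ _ _ _ φ hφ := by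
    simpa using smul_le_smul_of_nonneg_left (eval_mono φ hφ h) hr
  arch x y hx h := ext fun _ _ _ _ _ φ hφ => by
    refine ArchVectorLattice.arch _ (eval φ hφ y) (eval_mono φ hφ hx) fun n => ?_
    have h1 := eval_mono φ hφ (h n)
    have h2 : eval φ hφ (n • x) = n • eval φ hφ x := map_nsmul (lift φ hφ) n x
    rwa [h2] at h1

/-- The construction has the defining universal property. -/
theorem isTensorProduct : IsTensorProduct (tmul E F) where
  arch := inferInstance
  bimorphism := by
    refine ⟨fun e he f => ext fun G _ _ _ _ φ hφ => ?_, fun f hf e => ext fun G _ _ _ _ φ hφ => ?_⟩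
    · have := hφ.1 e he f
      simpa [abs] using this
    · have := hφ.2 f hf e
      simpa [abs] using this
  universal G _ _ _ _ φ hφ := by
    refine ⟨lift φ hφ, ⟨fun x => by simp [lift, abs], fun e f => rfl⟩, ?_⟩
    rintro h ⟨h1, h2⟩
    have key : ∀ x y, h (x ⊔ y) = h x ⊔ h y := fun x y => by
      have e1 : (2 : ℝ) • (x ⊔ y) = x + y + |x - y| := by
        rw [two_smul, ← two_nsmul, two_nsmul_sup_eq_add_add_abs_sub, abs_sub_comm]
      have e2 : (2 : ℝ) • (h x ⊔ h y) = h x + h y + |h x - h y| := by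
        rw [two_smul, ← two_nsmul, two_nsmul_sup_eq_add_add_abs_sub, abs_sub_comm]
      have e3 : (2 : ℝ) • h (x ⊔ y) = (2 : ℝ) • (h x ⊔ h y) := by
        rw [← map_smul, e1, e2, map_add, map_add, h1, map_sub]
      exact smul_right_injective _ (two_ne_zero) e3
    ext x
    induction x using Quotient.inductionOn with
    | _ a =>
      induction a with
      | pure e f => exact h2 e f
      | zero => exact h.map_zero
      | add a b iha ihb =>
        refine (h.map_add (Quotient.mk _ a) (Quotient.mk _ b)).trans ?_
        rw [iha, ihb]; rfl
      | smul r a iha =>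
        refine (h.map_smul r (Quotient.mk _ a)).trans ?_
        rw [iha]; rfl
      | sup a b iha ihb =>
        refine (key (Quotient.mk _ a) (Quotient.mk _ b)).trans ?_
        rw [iha, ihb]; rfl

end FremlinTensor

end Construction

/-! ### Square mean completeness and complex vector lattices -/

/-- The set `{f cos θ + g sin θ : θ ∈ [0, 2π]}`. -/
def rotations {E : Type*} [AddCommGroup E] [Module ℝ E] (f g : E) : Set E :=
  (fun θ : ℝ => Real.cos θ • f + Real.sin θ • g) '' Set.Icc 0 (2 * Real.pi)

/-- A vector lattice is square mean complete if `sup {f cos θ + g sin θ : θ ∈ [0, 2π]}`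
(which is `√2` times the square mean of `f` and `g`) exists for all `f` and `g`. -/
def SquareMeanComplete (E : Type*) [AddCommGroup E] [Lattice E] [Module ℝ E] : Prop :=
  ∀ f g : E, ∃ s : E, IsLUB (rotations f g) s

/-- An Archimedean modulus (in the sense of Mittelmeyer and Wolff) on a vector space over
`𝕜 = ℝ` or `ℂ`. -/
structure IsArchimedeanModulus (𝕜 : Type*) [RCLike 𝕜] {E : Type*} [AddCommGroup E] [Module 𝕜 E]
    (m : E → E) : Prop where
  idem : ∀ f, m (m f) = m f
  smul : ∀ (α : 𝕜) (f : E), m (α • f) = ((‖α‖ : ℝ) : 𝕜) • m f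
  triangle : ∀ f g, m (m (m f + m g) - m (f + g)) = m f + m g - m (f + g)
  span : Submodule.span 𝕜 (Set.range m) = ⊤
  arch : ∀ f g, (∀ n : ℕ, 0 < n → m (m g - (n : 𝕜) • m f) = m g - (n : 𝕜) • m f) → f = 0

/-- The vector space complexification `E + iE` of a real vector lattice `E`, realised as
`ℂ ⊗[ℝ] E`, is an Archimedean vector lattice over `ℂ` with real part `E`: it carries an
Archimedean modulus that extends the absolute value of `E`. -/
def ComplexificationIsArchimedean (E : Type*) [AddCommGroup E] [Lattice E] [Module ℝ E] : Prop :=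
  ∃ m : ℂ ⊗[ℝ] E → ℂ ⊗[ℝ] E, IsArchimedeanModulus ℂ m ∧
    ∀ f : E, m ((1 : ℂ) ⊗ₜ[ℝ] f) = (1 : ℂ) ⊗ₜ[ℝ] |f|

/-! ### Spaces of continuous functions -/

instance {A : Type*} [TopologicalSpace A] : ArchVectorLattice C(A, ℝ) where
  smul_le_smul_of_nonneg_left r hr f g h a := mul_le_mul_of_nonneg_left (h a) hr
  arch f g hf h := by
    ext a
    by_contra hne
    have hpos : 0 < f a := lt_of_le_of_ne (hf a) (Ne.symm hne)
    obtain ⟨n, hn⟩ := exists_nat_gt (g a / f a)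
    have h1 : (n : ℝ) * f a ≤ g a := by simpa using h n a
    rw [div_lt_iff₀ hpos] at hn
    linarith

section Functions

variable (A B : Type u) [TopologicalSpace A] [TopologicalSpace B]

/-- The bilinear map sending `(f, g)` to the function `(a, b) ↦ f a * g b`. -/
def mulMap : C(A, ℝ) →ₗ[ℝ] C(B, ℝ) →ₗ[ℝ] C(A × B, ℝ) :=
  LinearMap.mk₂ ℝ (fun f g => ⟨fun p => f p.1 * g p.2, by fun_prop⟩)
    (fun f f' g => by ext p; simp [add_mul])
    (fun r f g => by ext p; simp [mul_assoc])
    (fun f g g' => by ext p; simp [mul_add])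
    (fun r f g => by ext p; simp [mul_left_comm])

theorem isBimorphism_mulMap : IsBimorphism (mulMap A B) := by
  refine ⟨fun f hf g => ?_, fun g hg f => ?_⟩ <;> ext p
  · have : 0 ≤ f p.1 := hf p.1
    simp [mulMap, abs_mul, abs_of_nonneg this]
  · have : 0 ≤ g p.2 := hg p.2
    simp [mulMap, abs_mul, abs_of_nonneg this]

/-- The algebraic tensor product `C(A) ⊗ C(B)`, as a space of functions on `A × B`. -/
def finiteRank : Submodule ℝ C(A × B, ℝ) :=
  Submodule.span ℝ {h | ∃ f g, h = mulMap A B f g}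

/-- The canonical vector lattice homomorphism from the Fremlin tensor product of `C(A)` and `C(B)`
to `C(A × B)`, which sends `f ⊗ g` to `(a, b) ↦ f a * g b`. -/
def realize : FremlinTensor C(A, ℝ) C(B, ℝ) →ₗ[ℝ] C(A × B, ℝ) :=
  FremlinTensor.lift (mulMap A B) (isBimorphism_mulMap A B)

end Functions

/-- The inclusion `x ↦ x` of a set of real numbers, as a continuous function. -/
def coord (X : Set ℝ) : C(X, ℝ) := ⟨fun x => x, continuous_subtype_val⟩

end VecLat

/-! Two facts exclude `√(x² + y²)` from the range of `realize`. An element of the tensor product is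
a lattice expression in products `f ⊗ g`; near suitable points each supremum equals one of its two
arguments, so on a smaller open set the realized function has finite rank. But a finite-rank
function has sections spanning a finite-dimensional space, whereas the sections `x ↦ √(x² + b)`, `b
= y² > 0`, are linearly independent on every nonempty open `U`: the smallest `b` produces a
singularity that the others cannot cancel.

It remains to see that a supremum of the rotations, or a modulus of `f + ig`, would realize this
function. `realize` is not known to preserve infinite suprema, so the candidate `s` is squeezed
between `r - |q|` and `|r| + |q|`, where `(r, q)` is `(f, g)` rotated by `θ`. These bounds involve
only finitely many lattice operations, and at a given point some `θ` makes `q` vanish and `r` equal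
to the norm (`realize_eq_sqrt`). For the complexification, the modulus axioms must first be shown to
force `m (f + ig)` into `E` (`eq_zero_of_I_smul`). -/

/-! ### Shifted square roots and accumulation points on the line -/

open Filter Topology in
/-- Shifted square roots `u ↦ √(u + b)`, `b > 0`, are linearly independent near every `u₀ ≥ 0`. -/
theorem Real.coeff_eq_zero_of_frequently_sum_sqrt_eq_zero (s : Finset ℝ) (c : ℝ → ℝ)
    (hs : ∀ b ∈ s, 0 < b) {u₀ : ℝ} (hu₀ : 0 ≤ u₀)
    (h : ∃ᶠ u in 𝓝[≠] u₀, ∑ b ∈ s, c b * √(u + b) = 0) : ∀ b ∈ s, c b = 0 := by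
  induction s using Finset.induction_on_min with
  | empty => simp
  | insert a s ha ih =>
    have has : a ∉ s := fun hmem => lt_irrefl a (ha a hmem)
    have hapos : 0 < a := hs a (by simp)
    -- Since `a` is minimal, every `u + b` is positive on `(-a, ∞)`, so the identity theorem spreads
    -- the zeros near `u₀ ≥ 0` to this whole half-line.
    have han : AnalyticOnNhd ℝ (fun u => ∑ b ∈ insert a s, c b * √(u + b)) (Set.Ioi (-a)) := by
      intro u hu
      refine (ContDiffAt.sum fun b hb => contDiffAt_const.mul
        ((contDiffAt_id.add contDiffAt_const).sqrt ?_)).analyticAt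
      have hu' : -a < u := hu
      have hab : a ≤ b := by
        rcases Finset.mem_insert.1 hb with rfl | hb
        · exact le_rfl
        · exact (ha b hb).le
      simp only [id]
      linarith
    have hzero : ∀ u, -a < u → ∑ b ∈ insert a s, c b * √(u + b) = 0 := fun u hu =>
      han.eqOn_zero_of_preconnected_of_frequently_eq_zero isPreconnected_Ioi
        (show -a < u₀ by linarith) h hu
    -- At `-a` the other terms are differentiable, while `√(u + a)` has infinite slope. Their sum
    -- vanishes at `-a`, hence is at most `K (u + a)` nearby; dividing by `√(u + a)` leaves `|c a| ≤
    -- K √(u + a) → 0`.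
    have hca : c a = 0 := by
      have hd : DifferentiableAt ℝ (fun u => ∑ b ∈ s, c b * √(u + b)) (-a) := by
        refine DifferentiableAt.fun_sum fun b hb => ?_
        have : -a + b ≠ 0 := by linarith [ha b hb]
        fun_prop (disch := assumption)
      have hO := hd.isBigO_sub
      obtain ⟨K, hK⟩ := hO.bound
      have hlim : ∑ b ∈ s, c b * √(-a + b) = 0 := by
        have h1 : Tendsto (fun u => ∑ b ∈ insert a s, c b * √(u + b)) (𝓝[>] (-a))
            (𝓝 (∑ b ∈ insert a s, c b * √(-a + b))) :=
          (Continuous.tendsto (by fun_prop) _).mono_left nhdsWithin_le_nhds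
        have h2 : Tendsto (fun u => ∑ b ∈ insert a s, c b * √(u + b)) (𝓝[>] (-a)) (𝓝 0) :=
          tendsto_const_nhds.congr' (eventually_nhdsWithin_of_forall fun u hu => (hzero u hu).symm)
        simpa [Finset.sum_insert has] using tendsto_nhds_unique h1 h2
      have hbound : ∀ᶠ u in 𝓝[>] (-a), |c a| ≤ K * √(u + a) := by
        filter_upwards [hK.filter_mono nhdsWithin_le_nhds, self_mem_nhdsWithin] with u hu hua
        have hua' : 0 < u + a := by linarith [show -a < u from hua]
        have e := hzero u hua
        rw [Finset.sum_insert has] at e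
        rw [hlim, sub_zero, eq_neg_of_add_eq_zero_right e, Real.norm_eq_abs, Real.norm_eq_abs,
          abs_neg, abs_mul, abs_of_nonneg (Real.sqrt_nonneg _), sub_neg_eq_add,
          abs_of_pos hua'] at hu
        have hsq := Real.mul_self_sqrt hua'.le
        refine le_of_mul_le_mul_right ?_ (Real.sqrt_pos.2 hua')
        rwa [mul_assoc, hsq]
      have h0 : Tendsto (fun u => K * √(u + a)) (𝓝[>] (-a)) (𝓝 (K * √(-a + a))) :=
        (Continuous.tendsto (by fun_prop) _).mono_left nhdsWithin_le_nhds
      rw [neg_add_cancel, Real.sqrt_zero, mul_zero] at h0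
      exact abs_nonpos_iff.1 (ge_of_tendsto h0 hbound)
    intro b hb
    rcases Finset.mem_insert.1 hb with rfl | hb
    · exact hca
    · refine ih (fun b hb => hs b (Finset.mem_insert_of_mem hb)) ?_ b hb
      simpa [Finset.sum_insert has, hca] using h

open Filter Topology in
/-- Squaring maps punctured neighbourhoods to punctured neighbourhoods. -/
theorem tendsto_sq_nhdsNE (x : ℝ) : Tendsto (fun z : ℝ => z ^ 2) (𝓝[≠] x) (𝓝[≠] (x ^ 2)) := by
  refine tendsto_nhdsWithin_iff.2
    ⟨(Continuous.tendsto (by fun_prop) _).mono_left nhdsWithin_le_nhds, ?_⟩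
  by_cases hx : x = 0
  · subst hx
    filter_upwards [self_mem_nhdsWithin] with z hz
    simpa using hz
  · have hne : ∀ᶠ z in 𝓝[≠] x, z ≠ -x :=
      Eventually.filter_mono nhdsWithin_le_nhds
        (isOpen_ne.mem_nhds fun h : x = -x => hx (by linarith))
    filter_upwards [self_mem_nhdsWithin, hne] with z hz hz'
    simpa [sq_eq_sq_iff_eq_or_eq_neg] using ⟨hz, hz'⟩

open Filter Topology in
/-- A nonempty relatively open subset of a set without isolated points accumulates in itself. -/
theorem Preperfect.frequently_mem_of_isOpen {X : Set ℝ} (hX : Preperfect X) {U : Set X}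
    (hU : IsOpen U) {x : X} (hx : x ∈ U) :
    ∃ᶠ z in 𝓝[≠] (x : ℝ), ∃ hz : z ∈ X, (⟨z, hz⟩ : X) ∈ U := by
  obtain ⟨O, hO, rfl⟩ := isOpen_induced_iff.1 hU
  exact ((accPt_iff_frequently_nhdsNE.1 (hX x x.2)).and_eventually
    (Eventually.filter_mono nhdsWithin_le_nhds (hO.mem_nhds hx))).mono fun z hz => ⟨hz.1, hz.2⟩

/-! ### Functions of finite rank -/

namespace VecLat

/-- The sections of a function of finite rank span a finite-dimensional space. -/
theorem exists_finiteDimensional_sections {A B : Type u} [TopologicalSpace A]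
    [TopologicalSpace B] {h : C(A × B, ℝ)} (hh : h ∈ finiteRank A B) :
    ∃ P : Submodule ℝ (A → ℝ), FiniteDimensional ℝ P ∧ ∀ b, (fun a => h (a, b)) ∈ P := by
  induction hh using Submodule.span_induction with
  | mem h hh =>
    obtain ⟨f, g, rfl⟩ := hh
    refine ⟨Submodule.span ℝ {⇑f}, inferInstance, fun b => ?_⟩
    refine Submodule.mem_span_singleton.2 ⟨g b, ?_⟩
    ext a
    simp [mulMap, mul_comm]
  | zero => exact ⟨⊥, inferInstance, fun b => by simp [Pi.zero_def]⟩
  | add h k _ _ ih ik =>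
    obtain ⟨P, hP, hPm⟩ := ih
    obtain ⟨Q, hQ, hQm⟩ := ik
    exact ⟨P ⊔ Q, inferInstance, fun b => Submodule.add_mem_sup (hPm b) (hQm b)⟩
  | smul r h _ ih =>
    obtain ⟨P, hP, hPm⟩ := ih
    exact ⟨P, hP, fun b => P.smul_mem r (hPm b)⟩

/-- Functions of finite rank restrict to functions of finite rank. -/
theorem comp_subtype_mem_finiteRank {A B : Type u} [TopologicalSpace A] [TopologicalSpace B]
    {h : C(A × B, ℝ)} (hh : h ∈ finiteRank A B) (U : Set A) (W : Set B) :
    ∃ k ∈ finiteRank U W, ∀ p : U × W, k p = h (p.1, p.2) := by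
  induction hh using Submodule.span_induction with
  | mem h hh =>
    obtain ⟨f, g, rfl⟩ := hh
    exact ⟨mulMap U W (f.restrict U) (g.restrict W), Submodule.subset_span ⟨_, _, rfl⟩,
      fun p => rfl⟩
  | zero => exact ⟨0, zero_mem _, fun p => rfl⟩
  | add h k _ _ ih ik =>
    obtain ⟨h', hm, he⟩ := ih
    obtain ⟨k', km, ke⟩ := ik
    exact ⟨h' + k', add_mem hm km, fun p => by simp [he, ke]⟩
  | smul r h _ ih =>
    obtain ⟨h', hm, he⟩ := ih
    exact ⟨r • h', Submodule.smul_mem _ r hm, fun p => by simp [he]⟩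

open Filter Topology in
/-- The Euclidean norm is not of finite rank on any open box. -/
theorem euclideanNorm_notMem_finiteRank {X Y : Set ℝ} (hX : Preperfect X) (hY : Preperfect Y)
    {U : Set X} {W : Set Y} (hU : IsOpen U) (hU' : U.Nonempty) (hW : IsOpen W)
    (hW' : W.Nonempty) :
    ¬ ∃ h ∈ finiteRank U W, ∀ p : U × W,
        h p = √(((p.1 : X) : ℝ) ^ 2 + ((p.2 : Y) : ℝ) ^ 2) := by
  rintro ⟨h, hh, he⟩
  obtain ⟨P, hP, hPm⟩ := exists_finiteDimensional_sections hh
  obtain ⟨x₀, hx₀⟩ := hU'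
  obtain ⟨y₀, hy₀⟩ := hW'
  -- The sections at `y` and `-y` coincide, so squares serve as indices; `b = 0` is dropped because
  -- the independence lemma needs `b > 0`.
  set B : Set ℝ := {b | 0 < b ∧ ∃ y ∈ W, (y : ℝ) ^ 2 = b} with hB
  have hBinf : B.Infinite := by
    refine Set.Infinite.of_accPt (x := (y₀ : ℝ) ^ 2) (accPt_iff_frequently_nhdsNE.2 ?_)
    refine (tendsto_sq_nhdsNE y₀).frequently ?_
    have hne : ∀ᶠ z in 𝓝[≠] (y₀ : ℝ), z ≠ 0 := by
      by_cases h0 : (y₀ : ℝ) = 0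
      · rw [h0]; exact self_mem_nhdsWithin
      · exact Eventually.filter_mono nhdsWithin_le_nhds (isOpen_ne.mem_nhds h0)
    exact ((hY.frequently_mem_of_isOpen hW hy₀).and_eventually hne).mono
      fun z ⟨⟨hz, hzW⟩, hz0⟩ => ⟨by positivity, ⟨z, hz⟩, hzW, rfl⟩
  let v : ℝ → U → ℝ := fun b x => √(((x : X) : ℝ) ^ 2 + b)
  -- A linear relation on `U` is a relation in `u = x²`, valid at the squares of points of `U`,
  -- which accumulate at `x₀²`.
  have hli : LinearIndepOn ℝ v B := by
    rw [linearIndepOn_iff']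
    intro s c hs hc
    refine Real.coeff_eq_zero_of_frequently_sum_sqrt_eq_zero s c (fun b hb => (hs hb).1)
      (sq_nonneg (x₀ : ℝ)) ((tendsto_sq_nhdsNE x₀).frequently ?_)
    refine (hX.frequently_mem_of_isOpen hU hx₀).mono fun z ⟨hz, hzU⟩ => ?_
    simpa [v] using congrFun hc ⟨⟨z, hz⟩, hzU⟩
  have hvP : ∀ b : B, v b ∈ P := by
    rintro ⟨b, hb, y, hy, rfl⟩
    convert hPm ⟨y, hy⟩ using 1
    ext x
    exact (he (x, ⟨y, hy⟩)).symm
  have hli' : LinearIndependent ℝ (fun b : B => (⟨v b, hvP b⟩ : P)) :=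
    LinearIndependent.of_comp P.subtype hli
  have := hli'.finite_of_isNoetherian
  exact hBinf B.toFinite

/-! ### Realizing the tensor product by functions -/

section Realize

variable {A B : Type u} [TopologicalSpace A] [TopologicalSpace B]

/-- Every element of the Fremlin tensor product is locally of finite rank. -/
theorem exists_isOpen_realize_eq_finiteRank (t : FremlinTensor C(A, ℝ) C(B, ℝ))
    (O : Set (A × B)) (hO : IsOpen O) (hne : O.Nonempty) :
    ∃ V ⊆ O, IsOpen V ∧ V.Nonempty ∧
      ∃ g ∈ finiteRank A B, ∀ p ∈ V, realize A B t p = g p := by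
  induction t using Quotient.inductionOn with
  | _ a =>
  change ∃ V ⊆ O, IsOpen V ∧ V.Nonempty ∧
      ∃ g ∈ finiteRank A B, ∀ p ∈ V, a.eval (mulMap A B) p = g p
  -- `O` varies so that the second operand can be treated inside the open set found for the first.
  induction a generalizing O with
  | pure e f =>
    exact ⟨O, subset_rfl, hO, hne, _, Submodule.subset_span ⟨e, f, rfl⟩, fun _ _ => rfl⟩
  | zero => exact ⟨O, subset_rfl, hO, hne, 0, zero_mem _, fun _ _ => rfl⟩
  | add a b iha ihb =>
    obtain ⟨V, hVO, hV, hVne, g, hg, hag⟩ := iha O hO hne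
    obtain ⟨V', hV'V, hV', hV'ne, k, hk, hbk⟩ := ihb V hV hVne
    exact ⟨V', hV'V.trans hVO, hV', hV'ne, g + k, add_mem hg hk, fun p hp => by
      simp [Expr.eval, hag p (hV'V hp), hbk p hp]⟩
  | smul r a iha =>
    obtain ⟨V, hVO, hV, hVne, g, hg, hag⟩ := iha O hO hne
    exact ⟨V, hVO, hV, hVne, r • g, Submodule.smul_mem _ r hg, fun p hp => by
      simp [Expr.eval, hag p hp]⟩
  | sup a b iha ihb =>
    obtain ⟨V, hVO, hV, hVne, g, hg, hag⟩ := iha O hO hne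
    obtain ⟨V', hV'V, hV', hV'ne, k, hk, hbk⟩ := ihb V hV hVne
    -- Either `k` is the supremum on all of `V'`, or `k < g` at some point and hence on a nonempty
    -- open set, where `g` is the supremum.
    by_cases hle : ∀ p ∈ V', g p ≤ k p
    · exact ⟨V', hV'V.trans hVO, hV', hV'ne, k, hk, fun p hp => by
        simp [Expr.eval, hag p (hV'V hp), hbk p hp, hle p hp]⟩
    · push Not at hle
      obtain ⟨q, hq, hkg⟩ := hle
      refine ⟨V' ∩ {p | k p < g p}, Set.inter_subset_left.trans (hV'V.trans hVO),
        hV'.inter (isOpen_lt k.continuous g.continuous), ⟨q, hq, hkg⟩, g, hg, fun p hp => ?_⟩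
      simp [Expr.eval, hag p (hV'V hp.1), hbk p hp.1, (show k p < g p from hp.2).le]

theorem realize_mono {s t : FremlinTensor C(A, ℝ) C(B, ℝ)} (h : s ≤ t) (p : A × B) :
    realize A B s p ≤ realize A B t p :=
  FremlinTensor.eval_mono (mulMap A B) (isBimorphism_mulMap A B) h p

theorem realize_abs (t : FremlinTensor C(A, ℝ) C(B, ℝ)) (p : A × B) :
    realize A B |t| p = |realize A B t p| := by
  have h : realize A B |t| = |realize A B t| := by simp [realize, FremlinTensor.lift, abs]
  rw [h]; rfl

/-- An element squeezed between `r - |q|` and `|r| + |q|` for all rotations `(r, q)` of `(f, g)`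
is realized by the function `√(f² + g²)`. -/
theorem realize_eq_sqrt {f g s : FremlinTensor C(A, ℝ) C(B, ℝ)}
    (hlow : ∀ θ : ℝ, (Real.cos θ • f + Real.sin θ • g) - |Real.cos θ • g - Real.sin θ • f| ≤ s)
    (hupp : ∀ θ : ℝ, s ≤ |Real.cos θ • f + Real.sin θ • g| + |Real.cos θ • g - Real.sin θ • f|)
    (p : A × B) :
    realize A B s p = √(realize A B f p ^ 2 + realize A B g p ^ 2) := by
  set a := realize A B f p with ha
  set b := realize A B g p with hb
  -- The angle may depend on `p`: for `θ = arg z` the rotated pair takes the values `(‖z‖, 0)` at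
  -- `p`, and the two bounds meet. This includes `z = 0`.
  set z : ℂ := ⟨a, b⟩ with hz
  have hc : a = ‖z‖ * Real.cos z.arg := (Complex.norm_mul_cos_arg z).symm
  have hs : b = ‖z‖ * Real.sin z.arg := (Complex.norm_mul_sin_arg z).symm
  have hn : √(a ^ 2 + b ^ 2) = ‖z‖ := by
    rw [Complex.norm_eq_sqrt_sq_add_sq]
  have h1 := realize_mono (hlow z.arg) p
  have h2 := realize_mono (hupp z.arg) p
  simp only [map_add, map_sub, map_smul, ContinuousMap.add_apply, ContinuousMap.sub_apply,
    ContinuousMap.smul_apply, smul_eq_mul, realize_abs, ← ha, ← hb] at h1 h2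
  have e1 : Real.cos z.arg * a + Real.sin z.arg * b = ‖z‖ := by
    rw [hc, hs]
    linear_combination ‖z‖ * Real.sin_sq_add_cos_sq z.arg
  have e2 : Real.cos z.arg * b - Real.sin z.arg * a = 0 := by
    rw [hc, hs]; ring
  rw [e1, e2, abs_zero] at h1 h2
  rw [abs_of_nonneg (norm_nonneg z)] at h2
  rw [hn]
  linarith

end Realize

end VecLat

/-! ### Consequences of the modulus axioms -/

namespace VecLat

namespace IsArchimedeanModulus

variable {V : Type*} [AddCommGroup V] [Module ℂ V] {m : V → V}

theorem map_smul (hm : IsArchimedeanModulus ℂ m) (α : ℂ) (f : V) :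
    m (α • f) = ((‖α‖ : ℝ) : ℂ) • m f :=
  hm.smul α f

theorem map_zero (hm : IsArchimedeanModulus ℂ m) : m 0 = 0 := by
  simpa using hm.map_smul 0 0

theorem map_neg (hm : IsArchimedeanModulus ℂ m) (f : V) : m (-f) = m f := by
  simpa using hm.map_smul (-1) f

theorem map_I_smul (hm : IsArchimedeanModulus ℂ m) (f : V) : m (Complex.I • f) = m f := by
  simpa using hm.map_smul Complex.I f

theorem map_nonneg_smul (hm : IsArchimedeanModulus ℂ m) {r : ℝ} (hr : 0 ≤ r) {f : V}
    (hf : m f = f) : m ((r : ℂ) • f) = (r : ℂ) • f := by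
  rw [hm.map_smul, hf, Complex.norm_real, Real.norm_of_nonneg hr]

/-- The fixed points of `m` act as the positive cone. For fixed `f` and `g` the left side of the
triangle axiom is `m 0 = 0`. -/
theorem map_add_of_fixed (hm : IsArchimedeanModulus ℂ m) {f g : V} (hf : m f = f) (hg : m g = g) :
    m (f + g) = f + g := by
  have h := hm.triangle f g
  rw [hf, hg, sub_self, hm.map_zero] at h
  exact (sub_eq_zero.1 h.symm).symm

/-- The triangle inequality: `m f + m g - m (f + g)` is positive. -/
theorem map_triangle (hm : IsArchimedeanModulus ℂ m) (f g : V) :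
    m (m f + m g - m (f + g)) = m f + m g - m (f + g) := by
  have h := hm.triangle f g
  rwa [hm.map_add_of_fixed (hm.idem f) (hm.idem g)] at h

theorem eq_zero_of_fixed_neg (hm : IsArchimedeanModulus ℂ m) {f : V} (hf : m f = f)
    (hf' : m (-f) = -f) : f = 0 := by
  rw [hm.map_neg, hf] at hf'
  have h : (2 : ℂ) • f = 0 := by rw [two_smul]; nth_rw 2 [hf']; simp
  exact (smul_eq_zero.1 h).resolve_left two_ne_zero

/-- A difference of positive elements is dominated by its modulus. -/
theorem map_modulus_sub (hm : IsArchimedeanModulus ℂ m) {a b : V} (ha : m a = a) (hb : m b = b) :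
    m (m (a - b) - (a - b)) = m (a - b) - (a - b) := by
  -- The sum of the two arguments is `a`, which turns the triangle inequality into `m (a - b) + b -
  -- a ≥ 0`.
  have h := hm.map_triangle (a - b) b
  rw [sub_add_cancel, ha, hb] at h
  have e : m (a - b) + b - a = m (a - b) - (a - b) := by abel
  rwa [e] at h

/-- The modulus of `r` lies below every upper bound of `r` and `-r`. -/
theorem map_sub_modulus (hm : IsArchimedeanModulus ℂ m) {r w : V} (h₁ : m (w - r) = w - r)
    (h₂ : m (w + r) = w + r) : m (w - m r) = w - m r := by
  have h := hm.map_triangle (w + r) (-(w - r))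
  -- The triangle inequality for `w + r` and `-(w - r)` reads `2 m r ≤ 2 w`.
  have e : w + r + -(w - r) = (2 : ℂ) • r := by rw [two_smul]; abel
  rw [hm.map_neg, h₁, h₂, e, hm.map_smul] at h
  have e2 : w + r + (w - r) - ((‖(2 : ℂ)‖ : ℝ) : ℂ) • m r = (2 : ℂ) • (w - m r) := by
    simp only [two_smul, smul_sub, Complex.norm_ofNat, Complex.ofReal_ofNat]; abel
  have h' := hm.map_nonneg_smul (r := 2⁻¹) (by norm_num) (f := (2 : ℂ) • (w - m r))
    (by rw [e2] at h; exact h)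
  rwa [smul_smul, Complex.ofReal_inv, Complex.ofReal_ofNat, inv_mul_cancel₀ two_ne_zero,
    one_smul] at h'

/-- If `r` and `i r` are both differences of positive elements, then `r = 0`. -/
theorem eq_zero_of_I_smul (hm : IsArchimedeanModulus ℂ m) {r a b c d : V}
    (ha : m a = a) (hb : m b = b) (hc : m c = c) (hd : m d = d) (hr : r = a - b)
    (hq : Complex.I • r = c - d) : r = 0 := by
  have hmi : ∀ α : ℂ, m (r + α • r) = ((‖1 + α‖ : ℝ) : ℂ) • m r := fun α => by
    rw [← hm.map_smul, add_smul, one_smul]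
  set q := Complex.I • r with hqdef
  have hmq : m q = m r := hm.map_I_smul r
  -- Since `|1 ± i| = √2`, the element `w = √2 m r` is the modulus of `r ± q` and dominates all four
  -- `±r ± q`. Removing the signs one variable at a time gives `m r + m q ≤ w`, that is `2 m r ≤ √2
  -- m r`.
  set w := ((√2 : ℝ) : ℂ) • m r with hw
  have hn1 : ‖1 + Complex.I‖ = √2 := by
    rw [Complex.norm_eq_sqrt_sq_add_sq]; norm_num
  have hn2 : ‖1 + -Complex.I‖ = √2 := by
    rw [Complex.norm_eq_sqrt_sq_add_sq]; norm_num
  have hplus : m (r + q) = w := by rw [hqdef, hmi, hn1]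
  have hminus : m (r - q) = w := by
    rw [sub_eq_add_neg, hqdef, ← neg_smul, hmi, hn2]
  have key : ∀ p p' : V, m p = p → m p' = p' → m (m (p - p') - (p - p')) = m (p - p') - (p - p') :=
    fun p p' hp hp' => hm.map_modulus_sub hp hp'
  have h1 : m (w - (r + q)) = w - (r + q) := by
    have h := key (a + c) (b + d) (hm.map_add_of_fixed ha hc) (hm.map_add_of_fixed hb hd)
    have e : a + c - (b + d) = r + q := by rw [hr, hq]; abel
    rwa [e, hplus] at h
  have h2 : m (w - (r - q)) = w - (r - q) := by
    have h := key (a + d) (b + c) (hm.map_add_of_fixed ha hd) (hm.map_add_of_fixed hb hc)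
    have e : a + d - (b + c) = r - q := by rw [hr, hq]; abel
    rwa [e, hminus] at h
  have h3 : m (w + (r + q)) = w + (r + q) := by
    have h := key (b + d) (a + c) (hm.map_add_of_fixed hb hd) (hm.map_add_of_fixed ha hc)
    have e : b + d - (a + c) = -(r + q) := by rw [hr, hq]; abel
    rwa [e, hm.map_neg, hplus, sub_neg_eq_add] at h
  have h4 : m (w + (r - q)) = w + (r - q) := by
    have h := key (b + c) (a + d) (hm.map_add_of_fixed hb hc) (hm.map_add_of_fixed ha hd)
    have e : b + c - (a + d) = -(r - q) := by rw [hr, hq]; abel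
    rwa [e, hm.map_neg, hminus, sub_neg_eq_add] at h
  have h5 : m (w - r - m r) = w - r - m r := by
    rw [← hmq]
    refine hm.map_sub_modulus ?_ ?_
    · rw [sub_sub]; exact h1
    · rw [sub_add]; exact h2
  have h6 : m (w + r - m r) = w + r - m r := by
    rw [← hmq]
    refine hm.map_sub_modulus ?_ ?_
    · rw [add_sub_assoc]; exact h4
    · rw [add_assoc]; exact h3
  have h7 : m (w - m r - m r) = w - m r - m r := by
    refine hm.map_sub_modulus ?_ ?_
    · rw [sub_right_comm]; exact h5
    · rw [sub_add_eq_add_sub]; exact h6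
  have hmr : m r = 0 := by
    have hlt : 0 < 2 - √2 := by
      have : √2 < 2 := by rw [Real.sqrt_lt' two_pos]; norm_num
      linarith
    have e : w - m r - m r = -(((2 - √2 : ℝ) : ℂ) • m r) := by
      rw [hw, Complex.ofReal_sub, sub_smul, Complex.ofReal_ofNat, two_smul]; abel
    rw [e] at h7
    have h := hm.eq_zero_of_fixed_neg (hm.map_nonneg_smul hlt.le (hm.idem r)) h7
    exact (smul_eq_zero.1 h).resolve_left (by exact_mod_cast hlt.ne')
  -- As `m r = 0`, the bounds `±r ≤ m r` say that `-r` and `r` are both fixed by `m`.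
  have h8 := key a b ha hb
  have h9 := key b a hb ha
  rw [← hr, hmr, zero_sub] at h8
  rw [← neg_sub a b, ← hr, hm.map_neg, hmr, zero_sub, neg_neg] at h9
  exact hm.eq_zero_of_fixed_neg h9 h8

end IsArchimedeanModulus

/-! ### The modulus on the complexification -/

section Complexification

variable {E : Type*} [AddCommGroup E] [Module ℝ E]

theorem one_tmul_injective : Function.Injective fun e : E => (1 : ℂ) ⊗ₜ[ℝ] e := by
  refine Function.LeftInverse.injective
    (g := (TensorProduct.lid ℝ E) ∘ (Complex.reLm.rTensor E)) fun e => ?_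
  simp

theorem exists_eq_one_tmul_add_I_smul (v : ℂ ⊗[ℝ] E) :
    ∃ f g : E, v = (1 : ℂ) ⊗ₜ[ℝ] f + Complex.I • ((1 : ℂ) ⊗ₜ[ℝ] g) := by
  induction v with
  | zero => exact ⟨0, 0, by simp⟩
  | tmul z e =>
    refine ⟨z.re • e, z.im • e, ?_⟩
    rw [TensorProduct.smul_tmul', ← TensorProduct.smul_tmul, ← TensorProduct.smul_tmul,
      ← TensorProduct.add_tmul]
    congr 1
    apply Complex.ext <;> simp
  | add v w hv hw =>
    obtain ⟨f, g, rfl⟩ := hv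
    obtain ⟨f', g', rfl⟩ := hw
    exact ⟨f + f', g + g', by simp only [TensorProduct.tmul_add, smul_add]; abel⟩

variable [Lattice E] [ArchVectorLattice E] {m : ℂ ⊗[ℝ] E → ℂ ⊗[ℝ] E}

/-- Every positive element of the complexification comes from a positive element of `E`. -/
theorem IsArchimedeanModulus.exists_eq_one_tmul (hm : IsArchimedeanModulus ℂ m)
    (hE : ∀ f : E, m ((1 : ℂ) ⊗ₜ[ℝ] f) = (1 : ℂ) ⊗ₜ[ℝ] |f|) {v : ℂ ⊗[ℝ] E} (hv : m v = v) :
    ∃ f : E, 0 ≤ f ∧ v = (1 : ℂ) ⊗ₜ[ℝ] f := by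
  have hpos : ∀ f : E, 0 ≤ f → m ((1 : ℂ) ⊗ₜ[ℝ] f) = (1 : ℂ) ⊗ₜ[ℝ] f := fun f hf => by
    rw [hE, abs_of_nonneg hf]
  have hdec : ∀ f : E, (1 : ℂ) ⊗ₜ[ℝ] f = (1 : ℂ) ⊗ₜ[ℝ] f⁺ - (1 : ℂ) ⊗ₜ[ℝ] f⁻ := fun f => by
    rw [← TensorProduct.tmul_sub, posPart_sub_negPart]
  obtain ⟨f, g, rfl⟩ := exists_eq_one_tmul_add_I_smul v
  have hf1 := hpos _ (posPart_nonneg f)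
  have hf2 := hpos _ (negPart_nonneg f)
  have hg1 := hpos _ (posPart_nonneg g)
  have hg2 := hpos _ (negPart_nonneg g)
  -- With `v = f + ig` positive, `ig = (v + f⁻) - f⁺` and `i(ig) = g⁻ - g⁺` are both differences of
  -- positive elements.
  have h0 : Complex.I • ((1 : ℂ) ⊗ₜ[ℝ] g) = 0 := by
    refine hm.eq_zero_of_I_smul (hm.map_add_of_fixed hv hf2) hf1 hg2 hg1 ?_ ?_
    · rw [eq_sub_iff_add_eq, add_right_comm, ← eq_sub_iff_add_eq.1 (hdec f), add_comm]
    · rw [smul_smul, Complex.I_mul_I, neg_one_smul, hdec g, neg_sub]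
  rw [h0, add_zero] at hv ⊢
  rw [hE] at hv
  exact ⟨f, one_tmul_injective hv ▸ abs_nonneg f, rfl⟩

/-- In an Archimedean complexification, `m (f + i g)` is an element `s` of `E` that is squeezed
between `|r| - |q|` and `|r| + |q|` for all rotations `(r, q)` of `(f, g)`. -/
theorem exists_of_complexificationIsArchimedean (h : ComplexificationIsArchimedean E) (f g : E) :
    ∃ s : E, ∀ θ : ℝ,
      |Real.cos θ • f + Real.sin θ • g| - |Real.cos θ • g - Real.sin θ • f| ≤ s ∧
      s ≤ |Real.cos θ • f + Real.sin θ • g| + |Real.cos θ • g - Real.sin θ • f| := by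
  obtain ⟨m, hm, hE⟩ := h
  have hnonneg : ∀ e : E, m ((1 : ℂ) ⊗ₜ[ℝ] e) = (1 : ℂ) ⊗ₜ[ℝ] e → 0 ≤ e := fun e he => by
    rw [hE] at he
    exact one_tmul_injective he ▸ abs_nonneg e
  obtain ⟨s, -, hs⟩ := hm.exists_eq_one_tmul hE
    (hm.idem ((1 : ℂ) ⊗ₜ[ℝ] f + Complex.I • ((1 : ℂ) ⊗ₜ[ℝ] g)))
  refine ⟨s, fun θ => ?_⟩
  set r := Real.cos θ • f + Real.sin θ • g with hr
  set q := Real.cos θ • g - Real.sin θ • f with hq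
  -- Passing to `(r, q)` multiplies `f + ig` by `e^{-iθ}`, which leaves the modulus equal to `s`.
  have hrot : (1 : ℂ) ⊗ₜ[ℝ] r + Complex.I • ((1 : ℂ) ⊗ₜ[ℝ] q) =
      Complex.exp (-θ * Complex.I) •
        ((1 : ℂ) ⊗ₜ[ℝ] f + Complex.I • ((1 : ℂ) ⊗ₜ[ℝ] g)) := by
    have hreal : ∀ (x : ℝ) (e : E), (1 : ℂ) ⊗ₜ[ℝ] (x • e) = (x : ℂ) • ((1 : ℂ) ⊗ₜ[ℝ] e) :=
      fun x e => by
        rw [← TensorProduct.smul_tmul, TensorProduct.smul_tmul']; simp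
    rw [hr, hq, TensorProduct.tmul_add, TensorProduct.tmul_sub]
    simp only [hreal]
    rw [Complex.exp_mul_I, Complex.cos_neg, Complex.sin_neg, Complex.ofReal_cos,
      Complex.ofReal_sin]
    match_scalars
    · ring
    · linear_combination Complex.sin θ * Complex.I_sq
  have hms : m ((1 : ℂ) ⊗ₜ[ℝ] r + Complex.I • ((1 : ℂ) ⊗ₜ[ℝ] q)) = (1 : ℂ) ⊗ₜ[ℝ] s := by
    rw [hrot, hm.map_smul, hs, ← Complex.ofReal_neg, Complex.norm_exp_ofReal_mul_I]; simp
  constructor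
  -- Writing `r = (r + iq) - iq` gives `|r| ≤ s + |q|`.
  · have h := hm.map_triangle ((1 : ℂ) ⊗ₜ[ℝ] r + Complex.I • ((1 : ℂ) ⊗ₜ[ℝ] q))
      (-(Complex.I • ((1 : ℂ) ⊗ₜ[ℝ] q)))
    rw [add_neg_cancel_right, hms, hm.map_neg, hm.map_I_smul, hE, hE, ← TensorProduct.tmul_add,
      ← TensorProduct.tmul_sub] at h
    exact sub_le_iff_le_add.2 (sub_nonneg.1 (hnonneg _ h))
  · have h := hm.map_triangle ((1 : ℂ) ⊗ₜ[ℝ] r) (Complex.I • ((1 : ℂ) ⊗ₜ[ℝ] q))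
    rw [hms, hm.map_I_smul, hE, hE, ← TensorProduct.tmul_add, ← TensorProduct.tmul_sub] at h
    exact sub_nonneg.1 (hnonneg _ h)

end Complexification

/-! ### Upper bounds of rotations -/

section Rotations

variable {E : Type*} [AddCommGroup E] [Module ℝ E]

/-- Periodicity frees the angle from `[0, 2π]`; the angle `arg z` used in `realize_eq_sqrt` can be
negative. -/
theorem mem_rotations (f g : E) (θ : ℝ) :
    Real.cos θ • f + Real.sin θ • g ∈ rotations f g := by
  obtain ⟨y, hy, hc⟩ : ∃ y ∈ Set.Ico 0 (0 + 2 * Real.pi), (Real.cos θ • f + Real.sin θ • g) =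
      Real.cos y • f + Real.sin y • g := by
    refine Function.Periodic.exists_mem_Ico (f := fun θ => Real.cos θ • f + Real.sin θ • g)
      (fun x => ?_) Real.two_pi_pos θ 0
    simp
  rw [zero_add] at hy
  exact ⟨y, Set.Ico_subset_Icc_self hy, hc.symm⟩

variable [Lattice E] [ArchVectorLattice E]

/-- `|r| - x • r` is a convex combination of the positive elements `|r| - r` and `|r| + r`. -/
theorem smul_le_abs_of_abs_le_one {x : ℝ} (hx : |x| ≤ 1) (r : E) : x • r ≤ |r| := by
  obtain ⟨h1, h2⟩ := abs_le.1 hx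
  have hpos : 0 ≤ ((1 + x) / 2) • (|r| - r) + ((1 - x) / 2) • (|r| + r) :=
    add_nonneg
      (smul_nonneg (by linarith) (sub_nonneg.2 (le_abs_self r)))
      (smul_nonneg (by linarith) (neg_le_iff_add_nonneg.1 (neg_le_abs r)))
  rw [← sub_nonneg]
  convert hpos using 1
  match_scalars <;> ring

/-- `|r| + |q|` is an upper bound of the rotations of `(f, g)` for every rotation `(r, q)`. -/
theorem abs_add_abs_mem_upperBounds_rotations (f g : E) (θ : ℝ) :
    |Real.cos θ • f + Real.sin θ • g| + |Real.cos θ • g - Real.sin θ • f| ∈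
      upperBounds (rotations f g) := by
  rintro _ ⟨φ, -, rfl⟩
  -- Rotating by `φ` is rotating by `θ` and then by `φ - θ`; the new coefficients are at most `1` in
  -- absolute value.
  have e : Real.cos φ • f + Real.sin φ • g =
      Real.cos (φ - θ) • (Real.cos θ • f + Real.sin θ • g) +
        Real.sin (φ - θ) • (Real.cos θ • g - Real.sin θ • f) := by
    rw [Real.cos_sub, Real.sin_sub]
    match_scalars
    · linear_combination -Real.cos φ * Real.sin_sq_add_cos_sq θ
    · linear_combination -Real.sin φ * Real.sin_sq_add_cos_sq θ
  dsimp only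
  rw [e]
  exact add_le_add (smul_le_abs_of_abs_le_one (Real.abs_cos_le_one _) _)
    (smul_le_abs_of_abs_le_one (Real.abs_sin_le_one _) _)

end Rotations

/-! ### The missing supremum and the missing modulus -/

/-- The Euclidean norm is not realized by an element of the Fremlin tensor product. -/
theorem not_exists_realize_eq_euclideanNorm {X Y : Set ℝ} (hX : X.Nonempty) (hY : Y.Nonempty)
    (hX' : Preperfect X) (hY' : Preperfect Y) :
    ¬ ∃ t : FremlinTensor C(X, ℝ) C(Y, ℝ), ∀ p : X × Y,
      realize X Y t p = √((p.1 : ℝ) ^ 2 + (p.2 : ℝ) ^ 2) := by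
  rintro ⟨t, ht⟩
  have := hX.to_subtype
  have := hY.to_subtype
  obtain ⟨V, -, hV, ⟨⟨x, y⟩, hxy⟩, g, hg, htg⟩ :=
    exists_isOpen_realize_eq_finiteRank t Set.univ isOpen_univ Set.univ_nonempty
  obtain ⟨U, W, hU, hW, hxU, hyW, hUW⟩ := isOpen_prod_iff.1 hV x y hxy
  obtain ⟨k, hk, hkg⟩ := comp_subtype_mem_finiteRank hg U W
  refine euclideanNorm_notMem_finiteRank hX' hY' hU ⟨x, hxU⟩ hW ⟨y, hyW⟩ ⟨k, hk, fun p => ?_⟩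
  rw [hkg, ← htg _ (hUW ⟨p.1.2, p.2.2⟩), ht]

theorem realize_tmul_coord_one {X Y : Set ℝ} (p : X × Y) :
    realize X Y (FremlinTensor.tmul C(X, ℝ) C(Y, ℝ) (coord X) 1) p = p.1 := by
  change (p.1 : ℝ) * 1 = p.1
  rw [mul_one]

theorem realize_tmul_one_coord {X Y : Set ℝ} (p : X × Y) :
    realize X Y (FremlinTensor.tmul C(X, ℝ) C(Y, ℝ) 1 (coord Y)) p = p.2 := by
  change 1 * (p.2 : ℝ) = p.2
  rw [one_mul]

/-- The coordinate functions have no square mean in the Fremlin tensor product. -/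
theorem not_exists_isLUB_rotations_coord {X Y : Set ℝ} (hX : X.Nonempty) (hY : Y.Nonempty)
    (hX' : Preperfect X) (hY' : Preperfect Y) :
    ¬ ∃ s : FremlinTensor C(X, ℝ) C(Y, ℝ),
      IsLUB (rotations (FremlinTensor.tmul C(X, ℝ) C(Y, ℝ) (coord X) 1)
        (FremlinTensor.tmul C(X, ℝ) C(Y, ℝ) 1 (coord Y))) s := by
  rintro ⟨s, hs⟩
  refine not_exists_realize_eq_euclideanNorm hX hY hX' hY' ⟨s, fun p => ?_⟩
  -- The lower bound holds because `s` is an upper bound of the rotations, the upper one because `s`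
  -- is the least.
  rw [realize_eq_sqrt (fun θ => (sub_le_self _ (abs_nonneg _)).trans
    (hs.1 (mem_rotations _ _ θ))) (fun θ => hs.2 (abs_add_abs_mem_upperBounds_rotations _ _ θ)) p,
    realize_tmul_coord_one, realize_tmul_one_coord]

/-- The modulus of `x ⊗ 1 + i (1 ⊗ y)` would be squeezed in the same way as the supremum. -/
theorem not_complexificationIsArchimedean {X Y : Set ℝ} (hX : X.Nonempty) (hY : Y.Nonempty)
    (hX' : Preperfect X) (hY' : Preperfect Y) :
    ¬ ComplexificationIsArchimedean (FremlinTensor C(X, ℝ) C(Y, ℝ)) := by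
  intro h
  obtain ⟨s, hs⟩ := exists_of_complexificationIsArchimedean h
    (FremlinTensor.tmul C(X, ℝ) C(Y, ℝ) (coord X) 1)
    (FremlinTensor.tmul C(X, ℝ) C(Y, ℝ) 1 (coord Y))
  refine not_exists_realize_eq_euclideanNorm hX hY hX' hY' ⟨s, fun p => ?_⟩
  rw [realize_eq_sqrt (fun θ => (sub_le_sub_right (le_abs_self _) _).trans (hs θ).1)
    (fun θ => (hs θ).2) p, realize_tmul_coord_one, realize_tmul_one_coord]

end VecLat

theorem theorem4p10 (X Y : Set ℝ) (hX : X.Nonempty) (hY : Y.Nonempty)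
    (hX' : Preperfect X) (hY' : Preperfect Y) :
    -- the Fremlin tensor product is not square mean complete
    ¬ VecLat.SquareMeanComplete (VecLat.FremlinTensor C(X, ℝ) C(Y, ℝ)) ∧
    -- its vector space complexification is not an Archimedean vector lattice over `ℂ`
    ¬ VecLat.ComplexificationIsArchimedean (VecLat.FremlinTensor C(X, ℝ) C(Y, ℝ)) ∧
    -- the witness: the square mean of the two coordinate functions is missing
    (¬ ∃ s : VecLat.FremlinTensor C(X, ℝ) C(Y, ℝ),
      IsLUB (VecLat.rotations
        (VecLat.FremlinTensor.tmul C(X, ℝ) C(Y, ℝ) (VecLat.coord X) 1)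
        (VecLat.FremlinTensor.tmul C(X, ℝ) C(Y, ℝ) 1 (VecLat.coord Y))) s) ∧
    (¬ ∃ t : VecLat.FremlinTensor C(X, ℝ) C(Y, ℝ), ∀ p : X × Y,
      VecLat.realize X Y t p = √((p.1 : ℝ) ^ 2 + (p.2 : ℝ) ^ 2)) ∧
    -- on no open box does the witness agree with an element of `C(U) ⊗ C(W)`
    (∀ (U : Set X) (W : Set Y), IsOpen U → U.Nonempty → IsOpen W → W.Nonempty →
      ¬ ∃ h ∈ VecLat.finiteRank U W, ∀ p : U × W,
        h p = √(((p.1 : X) : ℝ) ^ 2 + ((p.2 : Y) : ℝ) ^ 2)) ∧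
    -- whereas all elements of the Fremlin tensor product are locally of finite rank
    (∀ (t : VecLat.FremlinTensor C(X, ℝ) C(Y, ℝ)) (O : Set (X × Y)), IsOpen O → O.Nonempty →
      ∃ V ⊆ O, IsOpen V ∧ V.Nonempty ∧
        ∃ g ∈ VecLat.finiteRank X Y, ∀ p ∈ V, VecLat.realize X Y t p = g p) := by
  have hlub := VecLat.not_exists_isLUB_rotations_coord hX hY hX' hY'
  exact ⟨fun h => hlub (h _ _), VecLat.not_complexificationIsArchimedean hX hY hX' hY', hlub,
    VecLat.not_exists_realize_eq_euclideanNorm hX hY hX' hY',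
    fun U W hU hU' hW hW' => VecLat.euclideanNorm_notMem_finiteRank hX' hY' hU hU' hW hW',
    VecLat.exists_isOpen_realize_eq_finiteRank⟩
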